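/- Fix a first-order vocabulary $L$; models $M$ of $L$ are nonempty. \textbf{ID} (intuitionistic dependence logic) has the formulas $$\phi::=\alpha\mid{=}(t)\mid\bot\mid\phi\wedge\phi\mid\phi\ovee\phi\mid\phi\to\phi\mid\forall x\,\phi\mid\exists x\,\phi,$$ where $\alpha$ is a first-order atomic formula (an equation or a relational atom) of $L$ and $t$ is a term of $L$. An assignment on $M$ is a function from a finite set of variables into $M$; a team is a set $X$ of assignments on $M$ with a common domain. Satisfaction $M\models_X\phi$, for teams whose domain contains the free variables of $\phi$, is defined by: $M\models_X\alpha$ iff every $s\in X$ satisfies $\alpha$ in $M$ in the usual sense; $M\models_X{=}(t)$ iff $s(t)=s'(t)$ for all $s,s'\in X$; $M\models_X\bot$ iff $X=\emptyset$; $M\models_X\phi\wedge\psi$ iff $M\models_X\phi$ and $M\models_X\psi$; $M\models_X\phi\ovee\psi$ iff $M\models_X\phi$ or $M\models_X\psi$; $M\models_X\phi\to\psi$ iff for every $Y\subseteq X$, $M\models_Y\phi$ implies $M\models_Y\psi$; $M\models_X\forall x\,\phi$ iff $M\models_{X(M/x)}\phi$, where $X(M/x)=\{s(a/x): s\in X,\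 a\in M\}$; $M\models_X\exists x\,\phi$ iff $M\models_{X(F/x)}\phi$ for some $F:X\to M$, where $X(F/x)=\{s(F(s)/x): s\in X\}$. An \textbf{ID} sentence $\phi$ (no free variables) is true in $M$ iff $M\models_{\{\emptyset\}}\phi$, where $\emptyset$ is the empty assignment. \textbf{SO} is second-order logic over $L$ with quantification over individuals, functions and relations of all finite arities, under the standard (full) semantics. Theorem. (1) For every \textbf{SO} sentence $\psi$ over $L$ there is an \textbf{ID} sentence $\phi$ over $L$ such that for every model $M$ of $L$: $M\models\psi\iff M\models_{\{\emptyset\}}\phi$. (2) For every \textbf{ID} sentence $\phi$ over $L$ there is an \textbf{SO} sentence $\psi$ over $L$ such that for every model $M$ of $L$: $M\models\psi\iff M\models_{\{\emptyset\}}\phi$. -/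

import Mathlib

universe u v w

namespace TeamLogic

/-! ### Intuitionistic dependence logic

Variables are natural numbers; first-order terms over a language `L` are `L.Term ℕ`. -/

/-- Formulas of intuitionistic dependence logic **ID** over `L`:
first-order atoms, constancy atoms `=(t)`, `⊥`, `∧`, intuitionistic disjunction, intuitionistic
implication, and the two quantifiers. -/
inductive IDFormula (L : FirstOrder.Language.{u, v}) : Type (max u v)
  | equal (t₁ t₂ : L.Term ℕ) : IDFormula L
  | rel {n : ℕ} (R : L.Relations n) (ts : Fin n → L.Term ℕ) : IDFormula L
  | const (t : L.Term ℕ) : IDFormula L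
  | bot : IDFormula L
  | and (φ ψ : IDFormula L) : IDFormula L
  | or (φ ψ : IDFormula L) : IDFormula L
  | imp (φ ψ : IDFormula L) : IDFormula L
  | all (x : ℕ) (φ : IDFormula L) : IDFormula L
  | ex (x : ℕ) (φ : IDFormula L) : IDFormula L

/-- An assignment on `M`: a partial function from variables to `M`, `none` meaning that the
variable is outside the domain of the assignment. -/
abbrev Assignment (M : Type w) : Type w := ℕ → Option M

/-- The empty assignment. -/
def Assignment.empty (M : Type w) : Assignment M := fun _ => none

/-- `s(a/x)`. -/
def Assignment.set {M : Type w} (s : Assignment M) (x : ℕ) (a : M) : Assignment M :=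
  Function.update s x (some a)

open Classical in
/-- The value `s(t)` of a term under an assignment; it is defined (not `none`) exactly if every
variable of the term is in the domain of the assignment. -/
noncomputable def Assignment.value {L : FirstOrder.Language.{u, v}} {M : Type w} [L.Structure M]
    (s : Assignment M) : L.Term ℕ → Option M
  | .var x => s x
  | .func f ts =>
      if h : ∀ i, (s.value (ts i)).isSome then
        some (FirstOrder.Language.Structure.funMap f fun i => (s.value (ts i)).get (h i))
      else none

/-- A team: a set of assignments. Teams that arise in the evaluation of a formula
on a team whose members share one finite domain have this property again. -/
abbrev Team (M : Type w) : Type w := Set (Assignment M)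

/-- The supplement team `X(F/x)` for `F : X → M`. -/
def Team.supplement {M : Type w} (X : Team M) (x : ℕ) (F : X → M) : Team M :=
  Set.range fun s : X => s.1.set x (F s)

/-- The duplicate team `X(M/x)`. -/
def Team.duplicate {M : Type w} (X : Team M) (x : ℕ) : Team M :=
  {s' | ∃ s ∈ X, ∃ a : M, s' = s.set x a}

namespace IDFormula

variable {L : FirstOrder.Language.{u, v}}

/-- Team semantics `M ⊨_X φ`, for teams whose domain contains the free variables of `φ`. -/
def Sat (M : Type w) [L.Structure M] : IDFormula L → Team M → Prop
  | equal t₁ t₂, X => ∀ s ∈ X, ∃ a : M, s.value t₁ = some a ∧ s.value t₂ = some a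
  | rel R ts, X => ∀ s ∈ X, ∃ a, (∀ i, s.value (ts i) = some (a i)) ∧
      FirstOrder.Language.Structure.RelMap (M := M) R a
  | const t, X => ∀ s ∈ X, ∀ s' ∈ X, s.value t = s'.value t
  | bot, X => X = ∅
  | and φ ψ, X => φ.Sat M X ∧ ψ.Sat M X
  | or φ ψ, X => φ.Sat M X ∨ ψ.Sat M X
  | imp φ ψ, X => ∀ Y ⊆ X, φ.Sat M Y → ψ.Sat M Y
  | all x φ, X => φ.Sat M (X.duplicate x)
  | ex x φ, X => ∃ F : X → M, φ.Sat M (X.supplement x F)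

/-- The free variables of a formula. -/
def freeVars : IDFormula L → Set ℕ
  | equal t₁ t₂ => ↑(t₁.varFinset ∪ t₂.varFinset)
  | rel _ ts => ⋃ i, ↑(ts i).varFinset
  | const t => ↑t.varFinset
  | bot => ∅
  | and φ ψ => φ.freeVars ∪ ψ.freeVars
  | or φ ψ => φ.freeVars ∪ ψ.freeVars
  | imp φ ψ => φ.freeVars ∪ ψ.freeVars
  | all x φ => φ.freeVars \ {x}
  | ex x φ => φ.freeVars \ {x}

/-- A sentence is a formula without free variables. -/
def IsSentence (φ : IDFormula L) : Prop := φ.freeVars = ∅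

/-- A sentence is true in `M` if the team `{∅}` of the empty assignment satisfies it. -/
def IsTrue (M : Type w) [L.Structure M] (φ : IDFormula L) : Prop :=
  φ.Sat M {Assignment.empty M}

end IDFormula

/-! ### Second-order logic with standard (full) semantics -/

/-- The variables of second-order logic: individual variables, and for each arity `n` function
variables and relation variables. -/
inductive SOVar : Type
  | ind (x : ℕ) : SOVar
  | fn (n k : ℕ) : SOVar
  | rl (n k : ℕ) : SOVar

/-- Second-order terms, built from individual variables, function symbols and
function variables. -/
inductive SOTerm (L : FirstOrder.Language.{u, v}) : Type u
  | var (x : ℕ) : SOTerm L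
  | func {n : ℕ} (f : L.Functions n) (ts : Fin n → SOTerm L) : SOTerm L
  | fvar (n k : ℕ) (ts : Fin n → SOTerm L) : SOTerm L

/-- Second-order formulas. As usual in classical logic, the other connectives and the
existential quantifiers of the three sorts are abbreviations. -/
inductive SOFormula (L : FirstOrder.Language.{u, v}) : Type (max u v)
  | equal (t₁ t₂ : SOTerm L) : SOFormula L
  | rel {n : ℕ} (R : L.Relations n) (ts : Fin n → SOTerm L) : SOFormula L
  | rvar (n k : ℕ) (ts : Fin n → SOTerm L) : SOFormula L
  | falsum : SOFormula L
  | imp (φ ψ : SOFormula L) : SOFormula L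
  | all (x : ℕ) (φ : SOFormula L) : SOFormula L
  | allFn (n k : ℕ) (φ : SOFormula L) : SOFormula L
  | allRl (n k : ℕ) (φ : SOFormula L) : SOFormula L

/-- A valuation of all second-order variables in `M`. -/
structure SOVal (M : Type w) : Type w where
  /-- values of the individual variables -/
  ind : ℕ → M
  /-- values of the function variables, by arity and index -/
  fn : (n : ℕ) → ℕ → (Fin n → M) → M
  /-- values of the relation variables, by arity and index -/
  rl : (n : ℕ) → ℕ → Set (Fin n → M)

namespace SOVal

variable {M : Type w}

/-- Change the value of one individual variable. -/
def setInd (e : SOVal M) (x : ℕ) (a : M) : SOVal M :=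
  { e with ind := Function.update e.ind x a }

/-- Change the value of one function variable. -/
def setFn (e : SOVal M) (n k : ℕ) (F : (Fin n → M) → M) : SOVal M :=
  { e with fn := Function.update e.fn n (Function.update (e.fn n) k F) }

/-- Change the value of one relation variable. -/
def setRl (e : SOVal M) (n k : ℕ) (R : Set (Fin n → M)) : SOVal M :=
  { e with rl := Function.update e.rl n (Function.update (e.rl n) k R) }

end SOVal

namespace SOTerm

variable {L : FirstOrder.Language.{u, v}}

/-- The value of a second-order term. -/
def value {M : Type w} [L.Structure M] (e : SOVal M) : SOTerm L → M
  | var x => e.ind x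
  | func f ts => FirstOrder.Language.Structure.funMap f fun i => (ts i).value e
  | fvar n k ts => e.fn n k fun i => (ts i).value e

/-- The variables occurring in a second-order term. -/
def vars : SOTerm L → Set SOVar
  | var x => {SOVar.ind x}
  | func _ ts => ⋃ i, (ts i).vars
  | fvar n k ts => {SOVar.fn n k} ∪ ⋃ i, (ts i).vars

end SOTerm

namespace SOFormula

variable {L : FirstOrder.Language.{u, v}}

/-- Tarskian satisfaction; second-order quantifiers range over all functions and relations. -/
def Sat (M : Type w) [L.Structure M] : SOFormula L → SOVal M → Prop
  | equal t₁ t₂, e => t₁.value e = t₂.value e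
  | rel R ts, e => FirstOrder.Language.Structure.RelMap R fun i => (ts i).value e
  | rvar n k ts, e => (fun i => (ts i).value e) ∈ e.rl n k
  | falsum, _ => False
  | imp φ ψ, e => φ.Sat M e → ψ.Sat M e
  | all x φ, e => ∀ a : M, φ.Sat M (e.setInd x a)
  | allFn n k φ, e => ∀ F : (Fin n → M) → M, φ.Sat M (e.setFn n k F)
  | allRl n k φ, e => ∀ R : Set (Fin n → M), φ.Sat M (e.setRl n k R)

/-- The free variables, of all three sorts, of a second-order formula. -/
def freeVars : SOFormula L → Set SOVar
  | equal t₁ t₂ => t₁.vars ∪ t₂.vars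
  | rel _ ts => ⋃ i, (ts i).vars
  | rvar n k ts => {SOVar.rl n k} ∪ ⋃ i, (ts i).vars
  | falsum => ∅
  | imp φ ψ => φ.freeVars ∪ ψ.freeVars
  | all x φ => φ.freeVars \ {SOVar.ind x}
  | allFn n k φ => φ.freeVars \ {SOVar.fn n k}
  | allRl n k φ => φ.freeVars \ {SOVar.rl n k}

/-- A second-order sentence has no free variables of any sort. -/
def IsSentence (φ : SOFormula L) : Prop := φ.freeVars = ∅

/-- A second-order sentence is true in `M` if it is satisfied under every valuation
(the valuation is irrelevant for a sentence, and one exists if `M` is nonempty). -/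
def IsTrue (M : Type w) [L.Structure M] (φ : SOFormula L) : Prop :=
  ∀ e : SOVal M, φ.Sat M e

end SOFormula

end TeamLogic

namespace TeamLogic

variable {L : FirstOrder.Language.{u, v}} {M : Type w}

/-! ### Teams and blocks of variables -/

/-! For (1), a team simulates functions. Let `n` argument variables and one value variable range
over everything. The subteams in which the value depends on the arguments are exactly those
contained in the graph of a single function, attached to every assignment of the old team. Since
satisfaction is downward closed (`Sat.mono`), an implication from the dependence atom therefore
quantifies universally over functions, and `∃` together with that atom quantifies existentially
(`sat_allFun`, `sat_exFun`). A relation is coded as the set where a function takes a distinguished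
value `c`, kept in variable `0`; the empty relation is treated apart, because a one-element model
has no value other than `c`. Fresh blocks of variables leave earlier ones intact, so a team can
carry a whole valuation (`Represents`). An atom is evaluated by an implication that restricts the
team to the assignments whose stored arguments are the computed ones. The negation `φ → ⊥` speaks of
all nonempty subteams, and a subteam of an encoding need not encode anything; hence the translation
carries a sign and pushes negation to the atoms, whose truth value is uniform on the restricted team
(`sat_ofSO`).

For (2), fix `N` above all variables of the sentence. A team with a common domain below `N` is coded
faithfully by a set of `N`-tuples, that is, by an `N`-ary relation. Each clause of team semantics
becomes a second-order statement about this relation: implication quantifies over subrelations, and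
the quantifiers define a new relation from the old one (`sat_toSO`). -/

/-- Assign the tuple `v` to the variables `b, …, b + n - 1`. -/
def Assignment.setBlock {n : ℕ} (s : Assignment M) (b : ℕ) (v : Fin n → M) : Assignment M :=
  fun i => if h : b ≤ i ∧ i < b + n then some (v ⟨i - b, by omega⟩) else s i

namespace Assignment

theorem set_same (s : Assignment M) (x : ℕ) (a : M) : s.set x a x = some a := by
  simp [Assignment.set]

theorem set_of_ne (s : Assignment M) {x y : ℕ} (a : M) (h : y ≠ x) : s.set x a y = s y := by
  simp [Assignment.set, h]

theorem setBlock_apply {n : ℕ} (s : Assignment M) (b : ℕ) (v : Fin n → M) (i : Fin n) :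
    s.setBlock b v (b + i) = some (v i) := by
  simp [setBlock]

theorem setBlock_of_lt {n : ℕ} (s : Assignment M) {b i : ℕ} (v : Fin n → M) (h : i < b) :
    s.setBlock b v i = s i := by
  simp [setBlock, Nat.not_le.2 h]

theorem setBlock_of_ge {n : ℕ} (s : Assignment M) {b i : ℕ} (v : Fin n → M) (h : b + n ≤ i) :
    s.setBlock b v i = s i := by
  simp [setBlock, Nat.not_lt.2 h]

theorem setBlock_zero (s : Assignment M) (b : ℕ) (v : Fin 0 → M) : s.setBlock b v = s := by
  funext i
  exact dif_neg (by omega)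

theorem set_setBlock {n : ℕ} (s : Assignment M) (b : ℕ) (v : Fin n → M) (a : M) :
    (s.setBlock b v).set (b + n) a = s.setBlock b (Fin.snoc v a : Fin (n + 1) → M) := by
  funext i
  by_cases h1 : i = b + n
  · subst h1
    rw [set_same]
    have := s.setBlock_apply b (Fin.snoc v a : Fin (n + 1) → M) (Fin.last n)
    simpa using this.symm
  · rw [set_of_ne _ _ h1]
    rcases lt_or_ge i b with h2 | h2
    · rw [setBlock_of_lt _ _ h2, setBlock_of_lt _ _ h2]
    · rcases lt_or_ge i (b + n) with h3 | h3
      · obtain ⟨j, rfl⟩ := Nat.exists_eq_add_of_le h2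
        have hj : j < n := by omega
        have e1 := s.setBlock_apply b v ⟨j, hj⟩
        have e2 := s.setBlock_apply b (Fin.snoc v a : Fin (n + 1) → M) (Fin.castSucc ⟨j, hj⟩)
        rw [Fin.snoc_castSucc] at e2
        exact e1.trans e2.symm
      · rw [setBlock_of_ge _ _ h3, setBlock_of_ge _ _ (by omega)]

end Assignment

namespace Team

/-- The team `X(M/b, …, M/(b + n - 1))`. -/
def duplicateBlock (X : Team M) (b n : ℕ) : Team M :=
  {s' | ∃ s ∈ X, ∃ v : Fin n → M, s' = s.setBlock b v}

/-- Extend a team by all argument tuples of `f` on the variables `b, …, b + n - 1`, and by the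
value of `f` on the variable `b + n`. -/
def addFn (X : Team M) (b n : ℕ) (f : (Fin n → M) → M) : Team M :=
  {s' | ∃ s ∈ X, ∃ v : Fin n → M, s' = (s.setBlock b v).set (b + n) (f v)}

theorem duplicateBlock_zero (X : Team M) (b : ℕ) : X.duplicateBlock b 0 = X := by
  ext s
  simp [duplicateBlock, Assignment.setBlock_zero]

theorem duplicate_duplicateBlock (X : Team M) (b n : ℕ) :
    (X.duplicateBlock b n).duplicate (b + n) = X.duplicateBlock b (n + 1) := by
  ext s'
  constructor
  · rintro ⟨_, ⟨s, hs, v, rfl⟩, a, rfl⟩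
    exact ⟨s, hs, _, s.set_setBlock b v a⟩
  · rintro ⟨s, hs, v, rfl⟩
    refine ⟨_, ⟨s, hs, Fin.init v, rfl⟩, v (Fin.last n), ?_⟩
    rw [Assignment.set_setBlock, Fin.snoc_init_self]

theorem addFn_zero (X : Team M) (b : ℕ) (f : (Fin 0 → M) → M) :
    X.addFn b 0 f = (fun s => s.set b (f Fin.elim0)) '' X := by
  ext s'
  constructor
  · rintro ⟨s, hs, v, rfl⟩
    refine ⟨s, hs, ?_⟩
    rw [Assignment.setBlock_zero, Subsingleton.elim v Fin.elim0, Nat.add_zero]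
  · rintro ⟨s, hs, rfl⟩
    refine ⟨s, hs, Fin.elim0, ?_⟩
    rw [Assignment.setBlock_zero, Nat.add_zero]

end Team

/-! ### Derived formulas of intuitionistic dependence logic -/

namespace IDFormula

section

variable [L.Structure M]

/-- Team semantics is downward closed. -/
theorem Sat.mono {φ : IDFormula L} {X Y : Team M} (h : φ.Sat M X) (hY : Y ⊆ X) : φ.Sat M Y := by
  induction φ generalizing X Y with
  | equal | rel => exact fun s hs => h s (hY hs)
  | const => exact fun s hs s' hs' => h s (hY hs) s' (hY hs')
  | bot => exact Set.subset_eq_empty hY h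
  | and φ ψ ih1 ih2 => exact ⟨ih1 h.1 hY, ih2 h.2 hY⟩
  | or φ ψ ih1 ih2 => exact h.imp (ih1 · hY) (ih2 · hY)
  | imp φ ψ => exact fun Z hZ => h Z (hZ.trans hY)
  | all x φ ih =>
    refine ih h ?_
    rintro _ ⟨s, hs, a, rfl⟩
    exact ⟨s, hY hs, a, rfl⟩
  | ex x φ ih =>
    obtain ⟨F, hF⟩ := h
    refine ⟨fun s => F ⟨s.1, hY s.2⟩, ih hF ?_⟩
    rintro _ ⟨s, rfl⟩
    exact ⟨⟨s.1, hY s.2⟩, rfl⟩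

end

/-- A valid formula. -/
def top : IDFormula L := imp bot bot

/-- Conjunction of finitely many formulas. -/
def conj : {n : ℕ} → (Fin n → IDFormula L) → IDFormula L
  | 0, _ => top
  | _ + 1, φ => and (φ 0) (conj fun i => φ i.succ)

/-- A formula or its negation. -/
def lit (p : Bool) (φ : IDFormula L) : IDFormula L := if p then φ else imp φ bot

/-- Universal quantification of the variables `b, …, b + n - 1`. -/
def allBlock (b : ℕ) : ℕ → IDFormula L → IDFormula L
  | 0, φ => φ
  | n + 1, φ => allBlock b n (all (b + n) φ)

/-- The dependence atom `=(b, …, b + n - 1; b + n)`. -/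
def dep (b n : ℕ) : IDFormula L :=
  imp (conj fun i : Fin n => const (.var (b + i))) (const (.var (b + n)))

/-- Universal quantification over an `n`-ary function. -/
def allFun (b n : ℕ) (φ : IDFormula L) : IDFormula L :=
  allBlock b n (all (b + n) (imp (dep b n) φ))

/-- Existential quantification over an `n`-ary function. -/
def exFun (b n : ℕ) (φ : IDFormula L) : IDFormula L :=
  allBlock b n (ex (b + n) (and (dep b n) φ))

/-- Existential quantification over constant values of the variables `b, …, b + n - 1`. -/
def exBlock (b : ℕ) : ℕ → IDFormula L → IDFormula L
  | 0, φ => φ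
  | n + 1, φ => exBlock b n (exFun (b + n) 0 φ)

variable [L.Structure M]

theorem sat_top (X : Team M) : (top : IDFormula L).Sat M X := fun _ _ h => h

theorem sat_conj {n : ℕ} (φ : Fin n → IDFormula L) (X : Team M) :
    (conj φ).Sat M X ↔ ∀ i, (φ i).Sat M X := by
  induction n with
  | zero => exact ⟨fun _ i => i.elim0, fun _ => sat_top X⟩
  | succ n ih => rw [Fin.forall_fin_succ, ← ih]; rfl

theorem sat_allBlock (b n : ℕ) (φ : IDFormula L) (X : Team M) :
    (allBlock b n φ).Sat M X ↔ φ.Sat M (X.duplicateBlock b n) := by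
  induction n generalizing φ with
  | zero => rw [Team.duplicateBlock_zero]; rfl
  | succ n ih =>
    rw [allBlock, ih, ← Team.duplicate_duplicateBlock]
    rfl

/-- The implication ranges over subteams with constant arguments, whose members agree pairwise on
the arguments. Conversely, two-element subteams already test the dependence. -/
theorem sat_dep (b n : ℕ) (X : Team M) :
    (dep b n : IDFormula L).Sat M X ↔
      ∀ s ∈ X, ∀ s' ∈ X, (∀ i : Fin n, s (b + i) = s' (b + i)) → s (b + n) = s' (b + n) := by
  constructor
  · intro h s hs s' hs' hi
    refine h {s, s'} (by rintro _ (rfl | rfl) <;> assumption) ?_ s (by simp) s' (by simp)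
    rw [sat_conj]
    rintro i _ (rfl | rfl) _ (rfl | rfl) <;> simp [Assignment.value, hi]
  · intro h Y hY hc s hs s' hs'
    rw [sat_conj] at hc
    exact h s (hY hs) s' (hY hs') fun i => hc i s hs s' hs'

theorem dep_addFn (X : Team M) (b n : ℕ) (f : (Fin n → M) → M) :
    (dep b n : IDFormula L).Sat M (X.addFn b n f) := by
  rw [sat_dep]
  rintro _ ⟨s, -, v, rfl⟩ _ ⟨s', -, v', rfl⟩ h
  have : v = v' := by
    funext i
    have := h i
    rw [Assignment.set_of_ne _ _ (by omega), Assignment.set_of_ne _ _ (by omega),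
      Assignment.setBlock_apply, Assignment.setBlock_apply] at this
    exact Option.some.inj this
  rw [Assignment.set_same, Assignment.set_same, this]

/-- Negated literals on a team where the atom has the same truth value everywhere. -/
theorem sat_lit {p : Bool} {α : IDFormula L} {X : Team M} {P : Prop} (hX : X.Nonempty)
    (h : ∀ Y ⊆ X, Y.Nonempty → (α.Sat M Y ↔ P)) : (lit p α).Sat M X ↔ (P ↔ p = true) := by
  cases p
  -- The negation says that only the empty subteam satisfies the atom; this is why the hypothesis
  -- concerns every nonempty subteam and not `X` alone.
  · simp only [lit, Bool.false_eq_true, if_false, iff_false]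
    constructor
    · intro h' hP
      exact hX.ne_empty (h' X subset_rfl ((h X subset_rfl hX).2 hP))
    · intro hP Y hY hα
      by_contra hne
      exact hP ((h Y hY (Set.nonempty_iff_ne_empty.2 hne)).1 hα)
  · simpa [lit] using h X subset_rfl hX

variable [Nonempty M]

/-- A team with a functional dependence is contained in one that is given by a function. -/
theorem exists_fn_of_dep {b n : ℕ} {X : Team M}
    (h : (dep b n : IDFormula L).Sat M X) :
    ∃ f : (Fin n → M) → M, ∀ s ∈ X, ∀ v : Fin n → M, (∀ i : Fin n, s (b + i) = some (v i)) →
      ∀ a, s (b + n) = some a → f v = a := by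
  classical
  rw [sat_dep] at h
  have : ∀ v : Fin n → M, ∃ a : M, ∀ s ∈ X, (∀ i : Fin n, s (b + i) = some (v i)) →
      ∀ a', s (b + n) = some a' → a = a' := by
    intro v
    by_cases hv : ∃ s ∈ X, (∀ i : Fin n, s (b + i) = some (v i)) ∧ ∃ a, s (b + n) = some a
    · obtain ⟨s, hs, hsv, a, ha⟩ := hv
      refine ⟨a, fun s' hs' hsv' a' ha' => ?_⟩
      have := h s hs s' hs' fun i => by rw [hsv, hsv']
      rw [ha, ha'] at this
      exact Option.some.inj this
    -- Tuples that do not occur in the team impose no condition, so any default value serves.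
    · exact ⟨Classical.arbitrary M, fun s hs hsv a ha => (hv ⟨s, hs, hsv, a, ha⟩).elim⟩
  choose f hf using this
  exact ⟨f, fun s hs v => hf v s hs⟩

/-- Each graph team satisfies the dependence, and each subteam satisfying it lies in a graph team by
`exists_fn_of_dep`. By downward closure only the full graph teams have to be tested. -/
theorem sat_allFun (b n : ℕ) (φ : IDFormula L) (X : Team M) :
    (allFun b n φ).Sat M X ↔ ∀ f : (Fin n → M) → M, φ.Sat M (X.addFn b n f) := by
  rw [allFun, sat_allBlock]
  constructor
  · intro h f
    refine h _ ?_ (dep_addFn X b n f)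
    rintro _ ⟨s, hs, v, rfl⟩
    exact ⟨_, ⟨s, hs, v, rfl⟩, _, rfl⟩
  · intro h Y hY hd
    obtain ⟨f, hf⟩ := exists_fn_of_dep hd
    refine (h f).mono fun s' hs' => ?_
    obtain ⟨_, ⟨s, hs, v, rfl⟩, a, rfl⟩ := hY hs'
    refine ⟨s, hs, v, ?_⟩
    rw [hf _ hs' v (fun i => ?_) a (Assignment.set_same _ _ _)]
    rw [Assignment.set_of_ne _ _ (by omega), Assignment.setBlock_apply]

/-- Downward closure lets inclusions replace equalities: a witness `F` yields a function whose graph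
team lies inside the supplement, and a function yields a witness whose supplement lies inside the
graph team. -/
theorem sat_exFun (b n : ℕ) (φ : IDFormula L) (X : Team M) :
    (exFun b n φ).Sat M X ↔ ∃ f : (Fin n → M) → M, φ.Sat M (X.addFn b n f) := by
  rw [exFun, sat_allBlock]
  constructor
  · rintro ⟨F, hd, hφ⟩
    obtain ⟨f, hf⟩ := exists_fn_of_dep hd
    refine ⟨f, hφ.mono ?_⟩
    rintro _ ⟨s, hs, v, rfl⟩
    have hmem : s.setBlock b v ∈ X.duplicateBlock b n := ⟨s, hs, v, rfl⟩
    refine ⟨⟨_, hmem⟩, ?_⟩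
    have := hf ((s.setBlock b v).set (b + n) (F ⟨_, hmem⟩)) ⟨⟨_, hmem⟩, rfl⟩ v (fun i => ?_) _
      (Assignment.set_same _ _ _)
    · rw [this]
    · rw [Assignment.set_of_ne _ _ (by omega), Assignment.setBlock_apply]
  · rintro ⟨f, hf⟩
    choose! t ht v hv using fun s (hs : s ∈ X.duplicateBlock b n) => hs
    have hsub : (X.duplicateBlock b n).supplement (b + n) (fun s => f (v s.1)) ⊆
        X.addFn b n f := by
      rintro _ ⟨s, rfl⟩
      refine ⟨t s.1, ht _ s.2, v s.1, ?_⟩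
      rw [← hv _ s.2]
    exact ⟨fun s => f (v s.1), (dep_addFn X b n f).mono hsub, hf.mono hsub⟩

/-- A nullary function is one value for the whole team, whereas a bare `ex` could choose differently
at each assignment. -/
theorem sat_exFun_zero (b : ℕ) (φ : IDFormula L) (X : Team M) :
    (exFun b 0 φ).Sat M X ↔ ∃ a : M, φ.Sat M ((fun s => s.set b a) '' X) := by
  simp only [sat_exFun, Team.addFn_zero]
  exact ⟨fun ⟨f, h⟩ => ⟨_, h⟩, fun ⟨a, h⟩ => ⟨fun _ => a, h⟩⟩

theorem sat_exBlock (b n : ℕ) (φ : IDFormula L) (X : Team M) :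
    (exBlock b n φ).Sat M X ↔
      ∃ v : Fin n → M, φ.Sat M ((fun s => s.setBlock b v) '' X) := by
  induction n generalizing φ with
  | zero =>
    simp only [exBlock, Assignment.setBlock_zero, Set.image_id', exists_const]
  | succ n ih =>
    simp only [exBlock, ih, sat_exFun_zero, Set.image_image, Assignment.set_setBlock]
    constructor
    · rintro ⟨v, a, h⟩
      exact ⟨_, h⟩
    · rintro ⟨v, h⟩
      refine ⟨Fin.init v, v (Fin.last n), ?_⟩
      rwa [Fin.snoc_init_self]

end IDFormula

/-! ### Valuations encoded by teams -/

/-- The teams `X` and `X'` have the same restrictions to the variables below `b`. -/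
def Team.AgreeBelow (b : ℕ) (X X' : Team M) : Prop :=
  (∀ s' ∈ X', ∃ s ∈ X, ∀ i < b, s' i = s i) ∧ ∀ s ∈ X, ∃ s' ∈ X', ∀ i < b, s' i = s i

/-- Every tuple occurs in the team `X` as value of the variables `a, …, a + n - 1`, and the value
of `a + n` is always related to it by `P`. -/
def Team.Encodes (X : Team M) (a n : ℕ) (P : (Fin n → M) → M → Prop) : Prop :=
  (∀ s ∈ X, ∃ v y, (∀ i : Fin n, s (a + i) = some (v i)) ∧ s (a + n) = some y ∧ P v y) ∧
    ∀ v : Fin n → M, ∃ s ∈ X, ∀ i : Fin n, s (a + i) = some (v i)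

namespace Team

theorem agreeBelow_image {b : ℕ} {X : Team M} {g : Assignment M → Assignment M}
    (h : ∀ s, ∀ i < b, g s i = s i) : X.AgreeBelow b (g '' X) := by
  constructor
  · rintro _ ⟨s, hs, rfl⟩
    exact ⟨s, hs, h s⟩
  · exact fun s hs => ⟨g s, ⟨s, hs, rfl⟩, h s⟩

theorem agreeBelow_addFn [Nonempty M] (X : Team M) (b n : ℕ) (f : (Fin n → M) → M) :
    X.AgreeBelow b (X.addFn b n f) := by
  have key : ∀ (s : Assignment M) (v : Fin n → M) (a : M), ∀ i < b,
      (s.setBlock b v).set (b + n) a i = s i := by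
    intro s v a i hi
    rw [Assignment.set_of_ne _ _ (by omega), Assignment.setBlock_of_lt _ _ hi]
  constructor
  · rintro _ ⟨s, hs, v, rfl⟩
    exact ⟨s, hs, key s v _⟩
  · exact fun s hs => ⟨_, ⟨s, hs, fun _ => Classical.arbitrary M, rfl⟩, key s _ _⟩

theorem AgreeBelow.eq_some {b : ℕ} {X X' : Team M} (h : X.AgreeBelow b X') {x : ℕ} (hx : x < b)
    {a : M} (ha : ∀ s ∈ X, s x = some a) : ∀ s ∈ X', s x = some a := by
  intro s' hs'
  obtain ⟨s, hs, hss⟩ := h.1 s' hs'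
  rw [hss x hx, ha s hs]

/-- Encoding depends only on which restrictions to variables below `b` occur in the team. One half
of `AgreeBelow` transfers the correctness of values, the other the presence of every argument tuple.
-/
theorem AgreeBelow.encodes {b : ℕ} {X X' : Team M} (h : X.AgreeBelow b X') {a n : ℕ}
    (hb : a + n < b) {P : (Fin n → M) → M → Prop} (hP : X.Encodes a n P) : X'.Encodes a n P := by
  constructor
  · intro s' hs'
    obtain ⟨s, hs, hss⟩ := h.1 s' hs'
    obtain ⟨v, y, hv, hy, hvy⟩ := hP.1 s hs
    exact ⟨v, y, fun i => by rw [hss _ (by omega), hv], by rw [hss _ hb, hy], hvy⟩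
  · intro v
    obtain ⟨s, hs, hv⟩ := hP.2 v
    obtain ⟨s', hs', hss⟩ := h.2 s hs
    exact ⟨s', hs', fun i => by rw [hss _ (by omega), hv]⟩

theorem encodes_addFn {X : Team M} (hX : X.Nonempty) (b n : ℕ) {f : (Fin n → M) → M}
    {P : (Fin n → M) → M → Prop} (hP : ∀ v, P v (f v)) : (X.addFn b n f).Encodes b n P := by
  have key : ∀ (s : Assignment M) (v : Fin n → M) (a : M) (i : Fin n),
      (s.setBlock b v).set (b + n) a (b + i) = some (v i) := by
    intro s v a i
    rw [Assignment.set_of_ne _ _ (by omega), Assignment.setBlock_apply]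
  constructor
  · rintro _ ⟨s, -, v, rfl⟩
    exact ⟨v, f v, key s v _, Assignment.set_same _ _ _, hP v⟩
  · intro v
    obtain ⟨s, hs⟩ := hX
    exact ⟨_, ⟨s, hs, v, rfl⟩, key s v _⟩

end Team

/-- The team variables that stand for second-order variables: an individual variable is
represented by one variable, a function variable of arity `n` by a block of `n` variables for the
arguments followed by one for the value, and a relation variable is either interpreted as the empty
relation, or represented like a function. -/
structure Alloc : Type where
  /-- representatives of the individual variables -/
  ind : ℕ → ℕ
  /-- first representatives of the function variables -/
  fn : ℕ → ℕ → ℕ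
  /-- first representatives of the relation variables -/
  rl : ℕ → ℕ → Option ℕ

namespace Alloc

/-- Change the representative of one individual variable. -/
def setInd (A : Alloc) (x a : ℕ) : Alloc :=
  { A with ind := Function.update A.ind x a }

/-- Change the representatives of one function variable. -/
def setFn (A : Alloc) (n k a : ℕ) : Alloc :=
  { A with fn := Function.update A.fn n (Function.update (A.fn n) k a) }

/-- Change the representatives of one relation variable. -/
def setRl (A : Alloc) (n k : ℕ) (a : Option ℕ) : Alloc :=
  { A with rl := Function.update A.rl n (Function.update (A.rl n) k a) }

/-- The team `X` represents the relation `R` in the block that starts at `a`; membership is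
indicated by the value `c`. -/
def RepresentsRel (b : ℕ) (c : M) (X : Team M) {n : ℕ} (R : Set (Fin n → M)) : Option ℕ → Prop
  | none => R = ∅
  | some a => a + n < b ∧ X.Encodes a n fun v y => y = c ↔ v ∈ R

/-- The team `X` represents the values under `e` of the variables in `V`, using only
variables below `b`; the variable `0` has the constant value `c`. -/
structure Represents (V : Set SOVar) (b : ℕ) (A : Alloc) (e : SOVal M) (c : M) (X : Team M) :
    Prop where
  pos : 0 < b
  nonempty : X.Nonempty
  zero : ∀ s ∈ X, s 0 = some c
  ind : ∀ x, SOVar.ind x ∈ V → A.ind x < b ∧ ∀ s ∈ X, s (A.ind x) = some (e.ind x)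
  fn : ∀ n k, SOVar.fn n k ∈ V →
    A.fn n k + n < b ∧ X.Encodes (A.fn n k) n fun v y => y = e.fn n k v
  rl : ∀ n k, SOVar.rl n k ∈ V → RepresentsRel b c X (e.rl n k) (A.rl n k)

theorem RepresentsRel.of_agreeBelow {b b' : ℕ} {c : M} {X X' : Team M} {n : ℕ}
    {R : Set (Fin n → M)} {o : Option ℕ} (h : RepresentsRel b c X R o) (hb : b ≤ b')
    (hX : X.AgreeBelow b X') : RepresentsRel b' c X' R o := by
  cases o with
  | none => exact h
  | some a => exact ⟨h.1.trans_le hb, hX.encodes h.1 h.2⟩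

namespace Represents

variable {V : Set SOVar} {b : ℕ} {A : Alloc} {e : SOVal M} {c : M} {X : Team M}

theorem of_agreeBelow (h : Represents V b A e c X) {b' : ℕ} (hb : b ≤ b') {X' : Team M}
    (hX : X.AgreeBelow b X') : Represents V b' A e c X' where
  pos := h.pos.trans_le hb
  nonempty := by
    obtain ⟨s, hs⟩ := h.nonempty
    obtain ⟨s', hs', -⟩ := hX.2 s hs
    exact ⟨s', hs'⟩
  zero := hX.eq_some h.pos h.zero
  ind x hx := ⟨(h.ind x hx).1.trans_le hb, hX.eq_some (h.ind x hx).1 (h.ind x hx).2⟩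
  fn n k hk := ⟨(h.fn n k hk).1.trans_le hb, hX.encodes (h.fn n k hk).1 (h.fn n k hk).2⟩
  rl n k hk := (h.rl n k hk).of_agreeBelow hb hX

theorem setInd (h : Represents V b A e c X) {x a : ℕ} {m : M} (ha : a < b)
    (hm : ∀ s ∈ X, s a = some m) :
    Represents (insert (.ind x) V) b (A.setInd x a) (e.setInd x m) c X where
  pos := h.pos
  nonempty := h.nonempty
  zero := h.zero
  ind y hy := by
    by_cases hxy : y = x
    · subst hxy
      simpa [Alloc.setInd, SOVal.setInd] using ⟨ha, hm⟩
    · simpa [Alloc.setInd, SOVal.setInd, hxy] using h.ind y (by simpa [hxy] using hy)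
  fn n k hk := h.fn n k (by simpa using hk)
  rl n k hk := h.rl n k (by simpa using hk)

theorem setFn (h : Represents V b A e c X) {n k a : ℕ} {f : (Fin n → M) → M} (ha : a + n < b)
    (hf : X.Encodes a n fun v y => y = f v) :
    Represents (insert (.fn n k) V) b (A.setFn n k a) (e.setFn n k f) c X where
  pos := h.pos
  nonempty := h.nonempty
  zero := h.zero
  ind x hx := h.ind x (by simpa using hx)
  fn m l hl := by
    by_cases hm : m = n
    · subst hm
      by_cases hlk : l = k
      · subst hlk
        simpa [Alloc.setFn, SOVal.setFn] using ⟨ha, hf⟩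
      · simpa [Alloc.setFn, SOVal.setFn, hlk] using h.fn m l (by simpa [hlk] using hl)
    · simpa [Alloc.setFn, SOVal.setFn, hm] using h.fn m l (by simpa [hm] using hl)
  rl m l hl := h.rl m l (by simpa using hl)

theorem setRl (h : Represents V b A e c X) {n k : ℕ} {o : Option ℕ} {R : Set (Fin n → M)}
    (hR : RepresentsRel b c X R o) :
    Represents (insert (.rl n k) V) b (A.setRl n k o) (e.setRl n k R) c X where
  pos := h.pos
  nonempty := h.nonempty
  zero := h.zero
  ind x hx := h.ind x (by simpa using hx)
  fn m l hl := h.fn m l (by simpa using hl)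
  rl m l hl := by
    by_cases hm : m = n
    · subst hm
      by_cases hlk : l = k
      · subst hlk
        simpa [Alloc.setRl, SOVal.setRl] using hR
      · simpa [Alloc.setRl, SOVal.setRl, hlk] using h.rl m l (by simpa [hlk] using hl)
    · simpa [Alloc.setRl, SOVal.setRl, hm] using h.rl m l (by simpa [hm] using hl)

end Represents

end Alloc

/-! ### From second-order logic to intuitionistic dependence logic -/

namespace IDFormula

/-- Equality of variables. -/
def eqVar (x y : ℕ) : IDFormula L := equal (.var x) (.var y)

/-- The formula `φ`, relativized to those assignments that agree on the blocks of length `n`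
that start at `a` and at `b`. -/
def whenEq (a b n : ℕ) (φ : IDFormula L) : IDFormula L :=
  imp (conj fun i : Fin n => eqVar (a + i) (b + i)) φ

/-- The second-order term `t` has the value of the variable `x`; variables from `b` on are
auxiliary. -/
def termEq (A : Alloc) : SOTerm L → ℕ → ℕ → IDFormula L
  | .var y, _, x => eqVar (A.ind y) x
  | .func (n := n) f ts, b, x =>
      exBlock b n (and (conj fun i => termEq A (ts i) (b + n) (b + i))
        (equal (.func f fun i => .var (b + i)) (.var x)))
  | .fvar n k ts, b, x =>
      exBlock b n (and (conj fun i => termEq A (ts i) (b + n) (b + i))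
        (whenEq (A.fn n k) b n (eqVar (A.fn n k + n) x)))

/-- The formula `φ` with the values of the terms `ts` for the variables `b, …, b + n - 1`. -/
def withTerms (A : Alloc) {n : ℕ} (b : ℕ) (ts : Fin n → SOTerm L) (φ : IDFormula L) :
    IDFormula L :=
  exBlock b n (and (conj fun i => termEq A (ts i) (b + n) (b + i)) φ)

/-- Quantification over an `n`-ary function, universal or existential. -/
def quantFun (p : Bool) (b n : ℕ) (φ : IDFormula L) : IDFormula L :=
  if p then allFun b n φ else exFun b n φ

/-- Conjunction or disjunction. -/
def both (p : Bool) (φ ψ : IDFormula L) : IDFormula L :=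
  if p then and φ ψ else or φ ψ

/-- A relation variable at the arguments `b, …, b + n - 1`, or its negation. -/
def relAtom (p : Bool) (b n : ℕ) : Option ℕ → IDFormula L
  | none => lit p bot
  | some a => whenEq a b n (lit p (eqVar (a + n) 0))

/-- The translation of a second-order formula (if `p = true`) or of its negation. -/
def ofSO : SOFormula L → Bool → ℕ → Alloc → IDFormula L
  | .equal t₁ t₂, p, b, A => withTerms A b ![t₁, t₂] (lit p (eqVar b (b + 1)))
  | .rel R ts, p, b, A => withTerms A b ts (lit p (rel R fun i => .var (b + i)))
  | .rvar n k ts, p, b, A => withTerms A b ts (relAtom p b n (A.rl n k))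
  | .falsum, p, _, _ => lit p bot
  | .imp φ ψ, p, b, A => both (!p) (ofSO φ (!p) b A) (ofSO ψ p b A)
  | .all x φ, p, b, A => quantFun p b 0 (ofSO φ p (b + 1) (A.setInd x b))
  | .allFn n k φ, p, b, A => quantFun p b n (ofSO φ p (b + n + 1) (A.setFn n k b))
  | .allRl n k φ, p, b, A =>
      both p (ofSO φ p b (A.setRl n k none))
        (quantFun p b n (ofSO φ p (b + n + 1) (A.setRl n k (some b))))

/-- Every relation is empty, or the set of points where some function has the value `c`. -/
theorem forall_rel_iff_forall_fn {n : ℕ} (c : M) {P : Set (Fin n → M) → Prop} :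
    (∀ R, P R) ↔ P ∅ ∧ ∀ f : (Fin n → M) → M, P {v | f v = c} := by
  classical
  refine ⟨fun h => ⟨h _, fun f => h _⟩, fun ⟨h0, hf⟩ R => ?_⟩
  by_cases hM : ∃ d, d ≠ c
  · obtain ⟨d, hd⟩ := hM
    convert hf fun v => if v ∈ R then c else d
    ext v
    by_cases hv : v ∈ R <;> simp [hv, hd]
  -- In a one-element model every function is constantly `c`, which codes the full relation; the
  -- only other relation is the empty one.
  · push Not at hM
    rcases R.eq_empty_or_nonempty with rfl | ⟨v, hv⟩
    · exact h0
    · convert hf fun _ => c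
      ext v'
      have : v' = v := funext fun i => (hM _).trans (hM _).symm
      simp [this, hv]

variable [L.Structure M]

theorem sat_eqVar {x y : ℕ} {X : Team M} {a : M} (hx : ∀ s ∈ X, s x = some a) :
    (eqVar x y : IDFormula L).Sat M X ↔ ∀ s ∈ X, s y = some a := by
  refine forall₂_congr fun s hs => ?_
  simp [Assignment.value, hx s hs]

theorem sat_eqVar_iff {x y : ℕ} {X : Team M} {a a' : M} (hX : X.Nonempty)
    (hx : ∀ s ∈ X, s x = some a) (hy : ∀ s ∈ X, s y = some a') :
    (eqVar x y : IDFormula L).Sat M X ↔ a = a' := by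
  rw [sat_eqVar hx]
  obtain ⟨s, hs⟩ := hX
  constructor
  · intro h
    simpa [hy s hs, eq_comm] using h s hs
  · rintro rfl
    exact hy

theorem value_func (s : Assignment M) {n : ℕ} (f : L.Functions n) {ts : Fin n → L.Term ℕ}
    {v : Fin n → M} (h : ∀ i, s.value (ts i) = some (v i)) :
    s.value (.func f ts) = some (FirstOrder.Language.Structure.funMap f v) := by
  have h' : ∀ i, (s.value (ts i)).isSome := fun i => by simp [h]
  rw [Assignment.value, dif_pos h']
  congr 2
  funext i
  simp [h]

/-- Among the subteams satisfying the premise there is a largest one, and by downward closure it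
decides the implication. -/
theorem sat_whenEq {a b n : ℕ} {φ : IDFormula L} {X : Team M} {v : Fin n → M}
    (hv : ∀ i : Fin n, ∀ s ∈ X, s (b + i) = some (v i)) :
    (whenEq a b n φ).Sat M X ↔ φ.Sat M {s ∈ X | ∀ i : Fin n, s (a + i) = some (v i)} := by
  constructor
  · intro h
    refine h _ (Set.sep_subset _ _) ?_
    rw [sat_conj]
    intro i
    rw [sat_eqVar (a := v i) fun s hs => hs.2 i]
    exact fun s hs => hv i s hs.1
  · intro h Y hY hc
    refine h.mono fun s hs => ⟨hY hs, fun i => ?_⟩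
    rw [sat_conj] at hc
    obtain ⟨m, h1, h2⟩ := hc i s hs
    have h3 : s (b + i) = some m := h2
    rw [hv i s (hY hs)] at h3
    rw [h3]
    exact h1

variable {V : Set SOVar} {A : Alloc} {e : SOVal M} {c : M} {X : Team M}

/-- Totality of the encoding makes the restricted team nonempty. Its stored values may vary, but
whether they equal `c` does not, so `sat_lit` applies with either sign. -/
theorem sat_relAtom {p : Bool} {b n : ℕ} {o : Option ℕ} {R : Set (Fin n → M)} {b' : ℕ}
    {v : Fin n → M} (hX : X.Nonempty) (hR : Alloc.RepresentsRel b' c X R o)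
    (h0 : ∀ s ∈ X, s 0 = some c) (hv : ∀ i : Fin n, ∀ s ∈ X, s (b + i) = some (v i)) :
    (relAtom p b n o : IDFormula L).Sat M X ↔ (v ∈ R ↔ p = true) := by
  cases o with
  | none =>
    obtain rfl : R = ∅ := hR
    exact sat_lit hX fun Y _ hne => ⟨fun h => (hne.ne_empty h).elim, False.elim⟩
  | some a =>
    rw [relAtom, sat_whenEq hv]
    obtain ⟨s₀, hs₀, hv₀⟩ := hR.2.2 v
    refine sat_lit ⟨s₀, hs₀, hv₀⟩ fun Y hY hne => ?_
    have hval : ∀ s ∈ Y, ∃ y, s (a + n) = some y ∧ (y = c ↔ v ∈ R) := by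
      intro s hs
      obtain ⟨v', y, hv', hy, hvy⟩ := hR.2.1 s (hY hs).1
      obtain rfl : v' = v := by
        funext i
        have := (hv' i).symm.trans ((hY hs).2 i)
        exact Option.some.inj this
      exact ⟨y, hy, hvy⟩
    constructor
    · intro h
      obtain ⟨s, hs⟩ := hne
      obtain ⟨y, hy, hyR⟩ := hval s hs
      obtain ⟨m, h1, h2⟩ := h s hs
      have h1' : s (a + n) = some m := h1
      have h2' : s 0 = some m := h2
      rw [h0 s (hY hs).1] at h2'
      rw [hy, ← h2'] at h1'
      exact hyR.1 (Option.some.inj h1')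
    · intro h s hs
      obtain ⟨y, hy, hyR⟩ := hval s hs
      exact ⟨c, by rw [← hyR.2 h]; exact hy, h0 s (hY hs).1⟩

theorem sat_both {p : Bool} {φ ψ : IDFormula L} {P Q : Prop} (h1 : φ.Sat M X ↔ (P ↔ p = true))
    (h2 : ψ.Sat M X ↔ (Q ↔ p = true)) : (both p φ ψ).Sat M X ↔ (P ∧ Q ↔ p = true) := by
  cases p
  · simp only [both, Bool.false_eq_true, if_false, iff_false, Sat] at *
    rw [h1, h2]
    tauto
  · simp only [both, if_true, iff_true, Sat] at *
    rw [h1, h2]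

variable [Nonempty M]

/-- The conjuncts force the quantified tuple to consist of the values of the terms, so the
existential quantifier disappears. Correctness of `termEq` is a hypothesis here so that the lemma
can be used inside the induction on terms. -/
theorem sat_termEqs {n : ℕ} {b : ℕ} {ts : Fin n → SOTerm L} {φ : IDFormula L}
    (hX : Alloc.Represents V b A e c X)
    (ih : ∀ i : Fin n, ∀ X' : Team M, Alloc.Represents V (b + n) A e c X' → ∀ a,
      (∀ s ∈ X', s (b + i) = some a) →
        ((termEq A (ts i) (b + n) (b + i)).Sat M X' ↔ (ts i).value e = a)) :
    (withTerms A b ts φ).Sat M X ↔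
      φ.Sat M ((fun s => s.setBlock b fun i => (ts i).value e) '' X) := by
  rw [withTerms, sat_exBlock]
  have key : ∀ v : Fin n → M,
      (∀ i, (termEq A (ts i) (b + n) (b + i)).Sat M ((fun s => s.setBlock b v) '' X)) ↔
        (fun i => (ts i).value e) = v := by
    intro v
    rw [funext_iff]
    refine forall_congr' fun i => ih i _ ?_ _ ?_
    · exact hX.of_agreeBelow (by omega)
        (Team.agreeBelow_image fun s i hi => Assignment.setBlock_of_lt _ _ hi)
    · rintro _ ⟨s, -, rfl⟩
      exact Assignment.setBlock_apply _ _ _ _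
  simp only [Sat, sat_conj, key]
  exact exists_eq_left'

theorem sat_termEq (t : SOTerm L) (ht : t.vars ⊆ V) {b x : ℕ} {X : Team M}
    (hX : Alloc.Represents V b A e c X) (hx : x < b) {a : M} (ha : ∀ s ∈ X, s x = some a) :
    (termEq A t b x).Sat M X ↔ t.value e = a := by
  induction t generalizing b x X a with
  | var y =>
    exact sat_eqVar_iff hX.nonempty (hX.ind y (ht rfl)).2 ha
  | @func n f ts ih =>
    refine (sat_termEqs hX fun i X' hX' a h => ih i ?_ hX' (by omega) h).trans ?_
    · exact (Set.subset_iUnion (fun i => (ts i).vars) i).trans ht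
    · have hval : ∀ s ∈ (fun s => Assignment.setBlock s b fun i => (ts i).value e) '' X,
          s.value (.func f fun i : Fin n => .var (b + i) : L.Term ℕ) =
            some ((SOTerm.func f ts).value e) ∧ s x = some a := by
        rintro _ ⟨s, hs, rfl⟩
        refine ⟨value_func _ f fun i => ?_, ?_⟩
        · rw [Assignment.value]
          exact Assignment.setBlock_apply _ _ _ i
        · exact (Assignment.setBlock_of_lt _ _ hx).trans (ha s hs)
      constructor
      · intro h
        obtain ⟨s, hs⟩ := hX.nonempty.image fun s => Assignment.setBlock s b fun i => (ts i).value e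
        obtain ⟨m, h1, h2⟩ := h s hs
        rw [(hval s hs).1] at h1
        rw [Assignment.value, (hval s hs).2] at h2
        exact Option.some.inj (h1.trans h2.symm)
      · intro h s hs
        exact ⟨a, by rw [(hval s hs).1, h], (hval s hs).2⟩
  | fvar n k ts ih =>
    refine (sat_termEqs hX fun i X' hX' a h => ih i ?_ hX' (by omega) h).trans ?_
    · exact ((Set.subset_iUnion (fun i => (ts i).vars) i).trans Set.subset_union_right).trans ht
    · obtain ⟨hb, henc⟩ := hX.fn n k (ht (Or.inl rfl))
      have hagree : X.AgreeBelow b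
          ((fun s => Assignment.setBlock s b fun i => (ts i).value e) '' X) :=
        Team.agreeBelow_image fun s i hi => Assignment.setBlock_of_lt _ _ hi
      have henc' := hagree.encodes hb henc
      rw [sat_whenEq (v := fun i => (ts i).value e)]
      -- The restricted team must be nonempty, or the equation would hold vacuously; totality of the
      -- encoded function ensures this.
      · obtain ⟨s₀, hs₀, hv₀⟩ := henc'.2 fun i => (ts i).value e
        refine sat_eqVar_iff ⟨s₀, hs₀, hv₀⟩ ?_ fun s hs => hagree.eq_some hx ha s hs.1
        intro s hs
        obtain ⟨v, y, hv, hy, hvy⟩ := henc'.1 s hs.1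
        obtain rfl : v = fun i => (ts i).value e := by
          funext i
          exact Option.some.inj ((hv i).symm.trans (hs.2 i))
        rw [hy, hvy]
        rfl
      · rintro i _ ⟨s, -, rfl⟩
        exact Assignment.setBlock_apply _ _ _ i

theorem sat_withTerms {n : ℕ} {b : ℕ} {ts : Fin n → SOTerm L} {φ : IDFormula L}
    (hX : Alloc.Represents V b A e c X) (hts : ∀ i, (ts i).vars ⊆ V) :
    (withTerms A b ts φ).Sat M X ↔
      φ.Sat M ((fun s => s.setBlock b fun i => (ts i).value e) '' X) :=
  sat_termEqs hX fun i _ hX' _ h => sat_termEq (ts i) (hts i) hX' (by omega) h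

theorem sat_quantFun {p : Bool} {b n : ℕ} {φ : IDFormula L} {P : ((Fin n → M) → M) → Prop}
    (h : ∀ f, φ.Sat M (X.addFn b n f) ↔ (P f ↔ p = true)) :
    (quantFun p b n φ).Sat M X ↔ ((∀ f, P f) ↔ p = true) := by
  cases p
  · simp [quantFun, sat_exFun, h]
  · simp [quantFun, sat_allFun, h]

/-- Induction on `ψ` for both signs at once, since an implication flips the sign of its premise.
Quantifiers extend the team by a fresh block at `b`, which represents the newly bound variable. -/
theorem sat_ofSO (ψ : SOFormula L) (hψ : ψ.freeVars ⊆ V) (p : Bool) {b : ℕ}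
    (hX : Alloc.Represents V b A e c X) :
    (ofSO ψ p b A).Sat M X ↔ (ψ.Sat M e ↔ p = true) := by
  induction ψ generalizing V p b A e X with
  | equal t₁ t₂ =>
    obtain ⟨h1, h2⟩ := Set.union_subset_iff.1 hψ
    rw [ofSO, sat_withTerms hX (by simp [Fin.forall_fin_two, h1, h2])]
    refine sat_lit (hX.nonempty.image _) fun Y hY hne => sat_eqVar_iff hne ?_ ?_
    · intro s hs
      obtain ⟨s, -, rfl⟩ := hY hs
      exact Assignment.setBlock_apply _ _ _ (0 : Fin 2)
    · intro s hs
      obtain ⟨s, -, rfl⟩ := hY hs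
      exact Assignment.setBlock_apply _ _ _ (1 : Fin 2)
  | @rel n R ts =>
    rw [ofSO, sat_withTerms hX fun i => (Set.subset_iUnion (fun i => (ts i).vars) i).trans hψ]
    refine sat_lit (hX.nonempty.image _) fun Y hY hne => ?_
    have hval : ∀ s ∈ Y, ∀ i : Fin n, s.value (.var (b + i) : L.Term ℕ) =
        some ((ts i).value e) := by
      intro s hs i
      obtain ⟨s, -, rfl⟩ := hY hs
      rw [Assignment.value]
      exact Assignment.setBlock_apply _ _ _ i
    constructor
    · intro h
      obtain ⟨s, hs⟩ := hne
      obtain ⟨a, ha, hR⟩ := h s hs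
      obtain rfl : a = fun i => (ts i).value e := by
        funext i
        exact Option.some.inj ((ha i).symm.trans (hval s hs i))
      exact hR
    · exact fun h s hs => ⟨_, hval s hs, h⟩
  | rvar n k ts =>
    rw [ofSO, sat_withTerms hX fun i =>
      ((Set.subset_iUnion (fun i => (ts i).vars) i).trans Set.subset_union_right).trans hψ]
    have hagree : X.AgreeBelow b
        ((fun s => Assignment.setBlock s b fun i => (ts i).value e) '' X) :=
      Team.agreeBelow_image fun s i hi => Assignment.setBlock_of_lt _ _ hi
    have h := hX.of_agreeBelow le_rfl hagree
    refine sat_relAtom h.nonempty (h.rl n k (hψ (Or.inl rfl))) h.zero ?_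
    rintro i _ ⟨s, -, rfl⟩
    exact Assignment.setBlock_apply _ _ _ i
  | falsum =>
    exact sat_lit hX.nonempty fun Y _ hne => ⟨fun h => (hne.ne_empty h).elim, False.elim⟩
  | imp φ ψ ih1 ih2 =>
    obtain ⟨h1, h2⟩ := Set.union_subset_iff.1 hψ
    have k1 := ih1 h1 (!p) hX
    have k2 := ih2 h2 p hX
    clear ih1 ih2
    cases p <;> simp only [Bool.not_true, Bool.not_false, Bool.false_eq_true, iff_true,
      iff_false] at k1 k2 <;>
      simp [ofSO, both, Sat, k1, k2, SOFormula.Sat, imp_iff_not_or]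
  | all x φ ih =>
    -- An individual is treated as a nullary function, which keeps its value constant over the team.
    rw [ofSO, sat_quantFun (P := fun f => φ.Sat M (e.setInd x (f Fin.elim0)))]
    · refine iff_congr ?_ Iff.rfl
      exact ⟨fun h a => h fun _ => a, fun h f => h _⟩
    · intro f
      refine ih (Set.sdiff_singleton_subset_iff.1 hψ) p ?_
      refine (hX.of_agreeBelow (Nat.le_succ b) (X.agreeBelow_addFn b 0 f)).setInd
        (Nat.lt_succ_self b) ?_
      rw [Team.addFn_zero]
      rintro _ ⟨s, -, rfl⟩
      exact Assignment.set_same _ _ _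
  | allFn n k φ ih =>
    refine sat_quantFun fun f => ih (Set.sdiff_singleton_subset_iff.1 hψ) p ?_
    exact (hX.of_agreeBelow (by omega) (X.agreeBelow_addFn b n f)).setFn (by omega)
      (Team.encodes_addFn hX.nonempty b n fun _ => rfl)
  | allRl n k φ ih =>
    rw [SOFormula.Sat, forall_rel_iff_forall_fn c]
    refine sat_both ?_ (sat_quantFun fun f => ?_)
    · exact ih (Set.sdiff_singleton_subset_iff.1 hψ) p (hX.setRl (o := none) rfl)
    · refine ih (Set.sdiff_singleton_subset_iff.1 hψ) p ?_
      exact (hX.of_agreeBelow (by omega) (X.agreeBelow_addFn b n f)).setRl (o := some b)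
        ⟨by omega, Team.encodes_addFn hX.nonempty b n fun _ => Iff.rfl⟩

/-! #### Sentences -/

theorem finite_freeVars (φ : IDFormula L) : φ.freeVars.Finite := by
  induction φ with
  | equal | const => exact Finset.finite_toSet _
  | rel => exact Set.finite_iUnion fun _ => Finset.finite_toSet _
  | bot => exact Set.finite_empty
  | and _ _ h1 h2 | or _ _ h1 h2 | imp _ _ h1 h2 => exact h1.union h2
  | all _ _ h | ex _ _ h => exact h.sdiff

theorem freeVars_exBlock_subset (b n : ℕ) (φ : IDFormula L) :
    (exBlock b n φ).freeVars ⊆ φ.freeVars \ Set.Ico b (b + n) := by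
  induction n generalizing φ with
  | zero => simp [exBlock]
  | succ n ih =>
    refine (ih _).trans ?_
    rintro x ⟨h1, h2⟩
    simp only [exFun, allBlock, dep, conj, top, freeVars, Nat.add_zero, Set.mem_sdiff, Set.mem_union,
      Set.mem_empty_iff_false, Set.mem_singleton_iff, false_or, FirstOrder.Language.Term.varFinset,
      Finset.coe_singleton] at h1
    refine ⟨h1.1.resolve_left h1.2, fun h => ?_⟩
    have := h1.2
    simp only [Set.mem_Ico] at h h2
    omega

/-- Every second-order sentence is expressible in intuitionistic dependence logic. -/
theorem exists_sentence_of_SO (ψ : SOFormula L) (hψ : ψ.IsSentence) :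
    ∃ φ : IDFormula L, φ.IsSentence ∧
      ∀ (M : Type w) [L.Structure M] [Nonempty M], ψ.IsTrue M ↔ φ.IsTrue M := by
  -- Variable `0` is reserved for `c`, so auxiliary variables start at `1`. No second-order variable
  -- is free, so the initial allocation is a dummy.
  set φ : IDFormula L := ofSO ψ true 1 ⟨fun _ => 0, fun _ _ => 0, fun _ _ => none⟩ with hφ
  obtain ⟨m, hm⟩ := φ.finite_freeVars.bddAbove
  -- All possibly free variables of the translation are bound to constants. The block contains
  -- variable `0`, whose value plays the role of `c`; the truth of the translation does not depend
  -- on the chosen tuple.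
  refine ⟨exBlock 0 (m + 1) φ, ?_, fun M _ _ => ?_⟩
  · refine Set.subset_eq_empty (freeVars_exBlock_subset _ _ _) ?_
    refine Set.sdiff_eq_empty.2 fun x hx => ⟨Nat.zero_le x, ?_⟩
    have := hm hx
    omega
  · rw [IsTrue, sat_exBlock]
    have key : ∀ (v : Fin (m + 1) → M) (e : SOVal M),
        φ.Sat M ((fun s => s.setBlock 0 v) '' {Assignment.empty M}) ↔ ψ.Sat M e := by
      intro v e
      rw [hφ, sat_ofSO (V := ∅) (e := e) (c := v 0) ψ (le_of_eq hψ)]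
      · simp
      · refine ⟨Nat.one_pos, (Set.singleton_nonempty _).image _, ?_, ?_, ?_, ?_⟩
        · rintro _ ⟨s, -, rfl⟩
          exact s.setBlock_apply 0 v 0
        all_goals simp
    obtain ⟨a⟩ := ‹Nonempty M›
    constructor
    · intro h
      exact ⟨fun _ => a, (key _ ⟨fun _ => a, fun _ _ _ => a, fun _ _ => ∅⟩).2 (h _)⟩
    · rintro ⟨v, h⟩ e
      exact (key v e).1 h

end IDFormula

/-! ### From intuitionistic dependence logic to second-order logic -/

/-- Assign the tuple `v` to the individual variables `b, …, b + n - 1`. -/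
def SOVal.setBlock {n : ℕ} (e : SOVal M) (b : ℕ) (v : Fin n → M) : SOVal M :=
  { e with ind := fun i => if h : b ≤ i ∧ i < b + n then v ⟨i - b, by omega⟩ else e.ind i }

namespace SOVal

theorem setBlock_ind {n : ℕ} (e : SOVal M) (b : ℕ) (v : Fin n → M) (i : Fin n) :
    (e.setBlock b v).ind (b + i) = v i := by
  simp [setBlock]

theorem setBlock_ind_of_lt {n : ℕ} (e : SOVal M) {b i : ℕ} (v : Fin n → M) (h : i < b) :
    (e.setBlock b v).ind i = e.ind i :=
  dif_neg (by omega)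

theorem setBlock_ind_of_ge {n : ℕ} (e : SOVal M) {b i : ℕ} (v : Fin n → M) (h : b + n ≤ i) :
    (e.setBlock b v).ind i = e.ind i :=
  dif_neg (by omega)

theorem eq_of_components {e e' : SOVal M} (hind : e.ind = e'.ind) (hfn : e.fn = e'.fn)
    (hrl : e.rl = e'.rl) : e = e' := by
  cases e
  cases e'
  simp_all

theorem setBlock_zero (e : SOVal M) (b : ℕ) (v : Fin 0 → M) : e.setBlock b v = e :=
  eq_of_components (funext fun _ => dif_neg (by omega)) rfl rfl

theorem setInd_setBlock {n : ℕ} (e : SOVal M) (b : ℕ) (v : Fin n → M) (a : M) :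
    (e.setBlock b v).setInd (b + n) a = e.setBlock b (Fin.snoc v a : Fin (n + 1) → M) := by
  refine eq_of_components (funext fun i => ?_) rfl rfl
  by_cases h1 : i = b + n
  · subst h1
    have := e.setBlock_ind b (Fin.snoc v a : Fin (n + 1) → M) (Fin.last n)
    simpa [setInd] using this.symm
  · have h0 : ((e.setBlock b v).setInd (b + n) a).ind i = (e.setBlock b v).ind i := by
      simp [setInd, h1]
    rw [h0]
    rcases lt_or_ge i b with h2 | h2
    · rw [setBlock_ind_of_lt _ _ h2, setBlock_ind_of_lt _ _ h2]
    · rcases lt_or_ge i (b + n) with h3 | h3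
      · obtain ⟨j, rfl⟩ := Nat.exists_eq_add_of_le h2
        have hj : j < n := by omega
        have e1 := e.setBlock_ind b v ⟨j, hj⟩
        have e2 := e.setBlock_ind b (Fin.snoc v a : Fin (n + 1) → M) (Fin.castSucc ⟨j, hj⟩)
        rw [Fin.snoc_castSucc] at e2
        exact e1.trans e2.symm
      · rw [setBlock_ind_of_ge _ _ h3, setBlock_ind_of_ge _ _ (by omega)]

theorem setRl_rl (e : SOVal M) (n k : ℕ) (R : Set (Fin n → M)) : (e.setRl n k R).rl n k = R := by
  simp [setRl]

theorem setRl_rl_of_ne (e : SOVal M) (n : ℕ) {k l : ℕ} (R : Set (Fin n → M)) (h : l ≠ k) :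
    (e.setRl n k R).rl n l = e.rl n l := by
  simp [setRl, h]

theorem setFn_fn (e : SOVal M) (n k : ℕ) (f : (Fin n → M) → M) : (e.setFn n k f).fn n k = f := by
  simp [setFn]

end SOVal

theorem SOTerm.finite_vars (t : SOTerm L) : t.vars.Finite := by
  induction t with
  | var => exact Set.finite_singleton _
  | func _ _ ih => exact Set.finite_iUnion ih
  | fvar _ _ _ ih => exact (Set.finite_singleton _).union (Set.finite_iUnion ih)

/-! ### Derived second-order connectives and explicit definition of relations -/

namespace SOFormula

/-- Negation. -/
def neg (φ : SOFormula L) : SOFormula L := imp φ falsum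

/-- Conjunction. -/
def and (φ ψ : SOFormula L) : SOFormula L := neg (imp φ (neg ψ))

/-- Existential quantification of an individual variable. -/
def ex (x : ℕ) (φ : SOFormula L) : SOFormula L := neg (all x (neg φ))

/-- Existential quantification of a function variable. -/
def exFn (n k : ℕ) (φ : SOFormula L) : SOFormula L := neg (allFn n k (neg φ))

/-- Universal quantification of the individual variables `b, …, b + n - 1`. -/
def allBlock (b : ℕ) : ℕ → SOFormula L → SOFormula L
  | 0, φ => φ
  | n + 1, φ => allBlock b n (all (b + n) φ)

/-- The tuple of the variables `b, …, b + n - 1` belongs to a relation variable. -/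
def memRl (n k b : ℕ) : SOFormula L := rvar n k fun i => .var (b + i)

/-- The formula `φ` about the relation of all tuples, denoted by `0, …, n - 1`, that
satisfy `θ`. -/
def letRl (n k : ℕ) (θ φ : SOFormula L) : SOFormula L :=
  allRl n k (imp
    (allBlock 0 n (and (imp (memRl n k 0) θ) (imp θ (memRl n k 0)))) φ)

variable [L.Structure M]

theorem sat_neg (φ : SOFormula L) (e : SOVal M) : φ.neg.Sat M e ↔ ¬φ.Sat M e := Iff.rfl

theorem sat_and (φ ψ : SOFormula L) (e : SOVal M) :
    (φ.and ψ).Sat M e ↔ φ.Sat M e ∧ ψ.Sat M e := by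
  simp [and, neg, Sat]

theorem sat_ex (x : ℕ) (φ : SOFormula L) (e : SOVal M) :
    (φ.ex x).Sat M e ↔ ∃ a, φ.Sat M (e.setInd x a) := by
  simp [ex, neg, Sat]

theorem sat_exFn (n k : ℕ) (φ : SOFormula L) (e : SOVal M) :
    (φ.exFn n k).Sat M e ↔ ∃ f, φ.Sat M (e.setFn n k f) := by
  simp [exFn, neg, Sat]

theorem sat_allBlock (b n : ℕ) (φ : SOFormula L) (e : SOVal M) :
    (φ.allBlock b n).Sat M e ↔ ∀ v : Fin n → M, φ.Sat M (e.setBlock b v) := by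
  induction n generalizing φ with
  | zero => simp [allBlock, SOVal.setBlock_zero]
  | succ n ih =>
    rw [allBlock, ih]
    simp only [Sat, SOVal.setInd_setBlock]
    constructor
    · intro h v
      have := h (Fin.init v) (v (Fin.last n))
      rwa [Fin.snoc_init_self] at this
    · exact fun h v a => h _

theorem sat_memRl_setBlock (n k b : ℕ) (v : Fin n → M) (e : SOVal M) :
    (memRl n k b : SOFormula L).Sat M (e.setBlock b v) ↔ v ∈ e.rl n k := by
  have : (fun i : Fin n => (SOTerm.var (b + i) : SOTerm L).value (e.setBlock b v)) = v :=
    funext fun i => e.setBlock_ind b v i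
  rw [memRl, Sat, this]
  rfl

/-- The guard has `S` as its only solution, so the universal quantifier acts as a substitution.
Since `h` ranges over all `R`, the defining condition cannot depend on the variable being bound. -/
theorem sat_letRl {n k : ℕ} {θ φ : SOFormula L} {e : SOVal M} {S : Set (Fin n → M)}
    (h : ∀ R v, θ.Sat M ((e.setRl n k R).setBlock 0 v) ↔ v ∈ S) :
    (letRl n k θ φ).Sat M e ↔ φ.Sat M (e.setRl n k S) := by
  simp only [letRl, Sat, sat_allBlock, sat_and, sat_memRl_setBlock, h, SOVal.setRl_rl]
  constructor
  · exact fun h => h S fun v => ⟨id, id⟩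
  · intro h R hR
    obtain rfl : R = S := Set.ext fun v => ⟨(hR v).1, (hR v).2⟩
    exact h

/-! #### Universal closure -/

theorem finite_freeVars (φ : SOFormula L) : φ.freeVars.Finite := by
  induction φ with
  | equal t₁ t₂ => exact t₁.finite_vars.union t₂.finite_vars
  | rel _ ts => exact Set.finite_iUnion fun i => (ts i).finite_vars
  | rvar _ _ ts =>
    exact (Set.finite_singleton _).union (Set.finite_iUnion fun i => (ts i).finite_vars)
  | falsum => exact Set.finite_empty
  | imp _ _ h1 h2 => exact h1.union h2
  | all _ _ h | allFn _ _ _ h | allRl _ _ _ h => exact h.sdiff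

/-- A variable can be bound without changing the truth of a formula. -/
theorem exists_freeVars_sdiff (φ : SOFormula L) (x : SOVar) :
    ∃ ψ : SOFormula L, ψ.freeVars = φ.freeVars \ {x} ∧
      ∀ (M : Type w) [L.Structure M], ψ.IsTrue M ↔ φ.IsTrue M := by
  cases x with
  | ind x =>
    refine ⟨all x φ, rfl, fun M _ => ⟨fun h e => ?_, fun h e a => h _⟩⟩
    simpa [SOVal.setInd] using h e (e.ind x)
  | fn n k =>
    refine ⟨allFn n k φ, rfl, fun M _ => ⟨fun h e => ?_, fun h e a => h _⟩⟩
    simpa [SOVal.setFn] using h e (e.fn n k)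
  | rl n k =>
    refine ⟨allRl n k φ, rfl, fun M _ => ⟨fun h e => ?_, fun h e a => h _⟩⟩
    simpa [SOVal.setRl] using h e (e.rl n k)

/-- The universal closure of a formula. -/
theorem exists_closure (φ : SOFormula L) :
    ∃ ψ : SOFormula L, ψ.IsSentence ∧
      ∀ (M : Type w) [L.Structure M], ψ.IsTrue M ↔ φ.IsTrue M := by
  suffices h : ∀ S : Set SOVar, S.Finite → ∀ φ : SOFormula L, φ.freeVars ⊆ S →
      ∃ ψ : SOFormula L, ψ.IsSentence ∧
        ∀ (M : Type w) [L.Structure M], ψ.IsTrue M ↔ φ.IsTrue M from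
    h _ φ.finite_freeVars φ subset_rfl
  intro S hS
  induction S, hS using Set.Finite.induction_on with
  | empty => exact fun φ h => ⟨φ, Set.subset_eq_empty h rfl, fun M _ => Iff.rfl⟩
  | @insert x S _ _ ih =>
    intro φ h
    obtain ⟨χ, hχ, hφ⟩ := exists_freeVars_sdiff.{u, v, w} φ x
    obtain ⟨ψ, h1, h2⟩ := ih χ (by rw [hχ]; exact Set.sdiff_singleton_subset_iff.2 h)
    exact ⟨ψ, h1, fun M _ => (h2 M).trans (hφ M)⟩

end SOFormula

/-! #### Teams as relations -/

/-- The first-order term `t` with variables shifted by `b`, as a second-order term. -/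
def SOTerm.ofTerm (b : ℕ) : L.Term ℕ → SOTerm L
  | .var x => .var (b + x)
  | .func f ts => .func f fun i => ofTerm b (ts i)

theorem SOTerm.value_ofTerm [L.Structure M] {b : ℕ} {s : Assignment M} {e : SOVal M}
    (t : L.Term ℕ) (h : ∀ x ∈ t.varFinset, s x = some (e.ind (b + x))) :
    s.value t = some ((SOTerm.ofTerm b t).value e) := by
  induction t with
  | var x =>
    rw [Assignment.value]
    exact h x (by simp [FirstOrder.Language.Term.varFinset])
  | func f ts ih =>
    refine IDFormula.value_func s f fun i => ih i fun x hx => h x ?_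
    simp only [FirstOrder.Language.Term.varFinset, Finset.mem_biUnion, Finset.mem_univ, true_and]
    exact ⟨i, hx⟩

/-- The values of the variables `0, …, N - 1`, with default value `m`. -/
def Assignment.tuple (N : ℕ) (m : M) (s : Assignment M) : Fin N → M := fun i => (s i).getD m

theorem Assignment.tuple_set {N x : ℕ} (hx : x < N) (m a : M) (s : Assignment M) :
    (s.set x a).tuple N m = Function.update (s.tuple N m) ⟨x, hx⟩ a := by
  funext i
  by_cases hi : i = ⟨x, hx⟩
  · subst hi
    simp [tuple, set_same]
  · have : (i : ℕ) ≠ x := fun h => hi (Fin.ext h)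
    simp [tuple, set_of_ne, hi, this]

/-- All assignments in the team `X` have the domain `D`. -/
def Team.HasDomain (X : Team M) (D : Set ℕ) : Prop := ∀ s ∈ X, ∀ x, (s x).isSome ↔ x ∈ D

namespace Team.HasDomain

variable {X : Team M} {D : Set ℕ}

theorem set {s : Assignment M} (hs : ∀ x, (s x).isSome ↔ x ∈ D) (x : ℕ) (a : M) (y : ℕ) :
    (s.set x a y).isSome ↔ y ∈ insert x D := by
  by_cases h : y = x
  · subst h
    simp [Assignment.set_same]
  · simp [Assignment.set_of_ne, h, hs]

theorem duplicate (hX : X.HasDomain D) (x : ℕ) : (X.duplicate x).HasDomain (insert x D) := by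
  rintro _ ⟨s, hs, a, rfl⟩
  exact set (hX s hs) x a

theorem supplement (hX : X.HasDomain D) (x : ℕ) (F : X → M) :
    (X.supplement x F).HasDomain (insert x D) := by
  rintro _ ⟨s, rfl⟩
  exact set (hX s.1 s.2) x _

/-- Filling undefined entries with `m` could identify assignments with different domains; the common
domain rules this out. -/
theorem injOn_tuple (hX : X.HasDomain D) {N : ℕ} (hD : ∀ x ∈ D, x < N) (m : M) :
    Set.InjOn (Assignment.tuple N m) X := by
  intro s hs s' hs' h
  funext x
  by_cases hx : x ∈ D
  · obtain ⟨a, ha⟩ := Option.isSome_iff_exists.1 ((hX s hs x).2 hx)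
    obtain ⟨a', ha'⟩ := Option.isSome_iff_exists.1 ((hX s' hs' x).2 hx)
    have := congrFun h ⟨x, hD x hx⟩
    simp only [Assignment.tuple, ha, ha', Option.getD_some] at this
    rw [ha, ha', this]
  · rw [Option.not_isSome_iff_eq_none.1 (mt (hX s hs x).1 hx),
      Option.not_isSome_iff_eq_none.1 (mt (hX s' hs' x).1 hx)]

theorem value_ofTerm [L.Structure M] (hX : X.HasDomain D) {N : ℕ} (hD : ∀ x ∈ D, x < N) {m : M}
    {s : Assignment M} (hs : s ∈ X) {b : ℕ} {e : SOVal M}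
    (he : ∀ i : Fin N, e.ind (b + i) = s.tuple N m i) {t : L.Term ℕ} (ht : ↑t.varFinset ⊆ D) :
    s.value t = some ((SOTerm.ofTerm b t).value e) := by
  refine SOTerm.value_ofTerm t fun x hx => ?_
  obtain ⟨a, ha⟩ := Option.isSome_iff_exists.1 ((hX s hs x).2 (ht hx))
  rw [he ⟨x, hD x (ht hx)⟩]
  simp [Assignment.tuple, ha]

end Team.HasDomain

/-- The old value at `x` is lost by duplication, so membership asks for some `a` that restores a
tuple of the old team. This form is directly expressible in `toSO`. -/
theorem Team.image_tuple_duplicate {N x : ℕ} (hx : x < N) (m : M) (X : Team M) :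
    Assignment.tuple N m '' X.duplicate x =
      {v | ∃ a, Function.update v ⟨x, hx⟩ a ∈ Assignment.tuple N m '' X} := by
  ext v
  constructor
  · rintro ⟨_, ⟨s, hs, a, rfl⟩, rfl⟩
    refine ⟨s.tuple N m ⟨x, hx⟩, s, hs, ?_⟩
    rw [Assignment.tuple_set hx, Function.update_idem, Function.update_eq_self]
  · rintro ⟨a, s, hs, h⟩
    refine ⟨s.set x (v ⟨x, hx⟩), ⟨s, hs, _, rfl⟩, ?_⟩
    rw [Assignment.tuple_set hx, h, Function.update_idem, Function.update_eq_self]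

theorem Team.image_tuple_supplement {N x : ℕ} (hx : x < N) (m : M) (X : Team M) (F : X → M)
    {f : (Fin N → M) → M} (hf : ∀ s : X, f (s.1.tuple N m) = F s) :
    Assignment.tuple N m '' X.supplement x F =
      {v | ∃ a, Function.update v ⟨x, hx⟩ a ∈ Assignment.tuple N m '' X ∧
        v ⟨x, hx⟩ = f (Function.update v ⟨x, hx⟩ a)} := by
  ext v
  constructor
  · rintro ⟨_, ⟨s, rfl⟩, rfl⟩
    have h : Function.update ((s.1.set x (F s)).tuple N m) ⟨x, hx⟩ (s.1.tuple N m ⟨x, hx⟩) =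
        s.1.tuple N m := by
      rw [Assignment.tuple_set hx, Function.update_idem, Function.update_eq_self]
    refine ⟨s.1.tuple N m ⟨x, hx⟩, ?_⟩
    rw [h, hf]
    exact ⟨⟨s.1, s.2, rfl⟩, by rw [Assignment.tuple_set hx, Function.update_self]⟩
  · rintro ⟨a, ⟨s, hs, h⟩, hv⟩
    refine ⟨s.set x (F ⟨s, hs⟩), ⟨⟨s, hs⟩, rfl⟩, ?_⟩
    rw [Assignment.tuple_set hx, h, ← hf ⟨s, hs⟩, h, ← hv, Function.update_idem,
      Function.update_eq_self]

/-! ### Team semantics as statements about relations -/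

namespace IDFormula

/-- An upper bound for the bound variables of a formula. -/
def boundSup : IDFormula L → ℕ
  | equal _ _ => 0
  | rel _ _ => 0
  | const _ => 0
  | bot => 0
  | and φ ψ => max φ.boundSup ψ.boundSup
  | or φ ψ => max φ.boundSup ψ.boundSup
  | imp φ ψ => max φ.boundSup ψ.boundSup
  | all x φ => max (x + 1) φ.boundSup
  | ex x φ => max (x + 1) φ.boundSup

/-- The variables `0, …, N - 1`, with `x` replaced by `N`. -/
def replaceVar (N x : ℕ) (i : Fin N) : SOTerm L := .var (if (i : ℕ) = x then N else i)

/-- The translation of a formula with variables below `N` to a formula about the relation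
variable with arity `N` and index `k`, which represents a team. -/
def toSO (N : ℕ) : IDFormula L → ℕ → SOFormula L
  | equal t₁ t₂, k => .allBlock 0 N (.imp (.memRl N k 0) (.equal (.ofTerm 0 t₁) (.ofTerm 0 t₂)))
  | rel R ts, k => .allBlock 0 N (.imp (.memRl N k 0) (.rel R fun i => .ofTerm 0 (ts i)))
  | const t, k =>
      .allBlock 0 N (.imp (.memRl N k 0)
        (.allBlock N N (.imp (.memRl N k N) (.equal (.ofTerm 0 t) (.ofTerm N t)))))
  | bot, k => .allBlock 0 N (.imp (.memRl N k 0) .falsum)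
  | and φ ψ, k => .and (φ.toSO N k) (ψ.toSO N k)
  | or φ ψ, k => .imp (.neg (φ.toSO N k)) (ψ.toSO N k)
  | imp φ ψ, k =>
      .allRl N (k + 1) (.imp (.allBlock 0 N (.imp (.memRl N (k + 1) 0) (.memRl N k 0)))
        (.imp (φ.toSO N (k + 1)) (ψ.toSO N (k + 1))))
  | all x φ, k =>
      .letRl N (k + 1) (.ex N (.rvar N k (replaceVar N x))) (φ.toSO N (k + 1))
  | ex x φ, k =>
      -- Function index `0` can be reused under nesting, since the function only serves to define
      -- the next team; that team needs a fresh index because its definition refers to the current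
      -- one.
      .exFn N 0 (.letRl N (k + 1)
        (.ex N (.and (.rvar N k (replaceVar N x))
          (.equal (.var x) (.fvar N 0 (replaceVar N x)))))
        (φ.toSO N (k + 1)))

variable [L.Structure M]

theorem value_replaceVar {N x : ℕ} (hx : x < N) (e : SOVal M) (v : Fin N → M) (a : M) :
    (fun i => (replaceVar N x i : SOTerm L).value ((e.setBlock 0 v).setInd N a)) =
      Function.update v ⟨x, hx⟩ a := by
  funext i
  by_cases hi : i = ⟨x, hx⟩
  · subst hi
    simp [replaceVar, SOTerm.value, SOVal.setInd]
  · have h1 : (i : ℕ) ≠ x := fun h => hi (Fin.ext h)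
    have h2 : (i : ℕ) ≠ N := i.2.ne
    have h3 := e.setBlock_ind 0 v i
    rw [Nat.zero_add] at h3
    simp [replaceVar, SOTerm.value, SOVal.setInd, h1, h2, hi, h3]

/-- The valuation matters only through the relation coding `X`, which allows everything else to be
overwritten. The domain `D` grows at quantifiers but stays below `N` by `hbound`. -/
theorem sat_toSO {N : ℕ} {m : M} (φ : IDFormula L) {D : Set ℕ} (hD : ∀ x ∈ D, x < N)
    (hfree : φ.freeVars ⊆ D) (hbound : φ.boundSup ≤ N) {X : Team M} (hX : X.HasDomain D) {k : ℕ}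
    {e : SOVal M} (he : e.rl N k = Assignment.tuple N m '' X) :
    (φ.toSO N k).Sat M e ↔ φ.Sat M X := by
  induction φ generalizing D X k e with
  | equal t₁ t₂ =>
    simp only [freeVars, Finset.coe_union, Set.union_subset_iff] at hfree
    simp only [toSO, SOFormula.sat_allBlock, SOFormula.Sat, SOFormula.sat_memRl_setBlock, he,
      Set.forall_mem_image, Sat]
    refine forall₂_congr fun s hs => ?_
    have hv : ∀ i : Fin N, (e.setBlock 0 (s.tuple N m)).ind (0 + i) = s.tuple N m i :=
      e.setBlock_ind 0 _
    rw [hX.value_ofTerm hD hs hv hfree.1, hX.value_ofTerm hD hs hv hfree.2]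
    simp [eq_comm]
  | rel R ts =>
    simp only [toSO, SOFormula.sat_allBlock, SOFormula.Sat, SOFormula.sat_memRl_setBlock, he,
      Set.forall_mem_image, Sat]
    refine forall₂_congr fun s hs => ?_
    have hv : ∀ i : Fin N, (e.setBlock 0 (s.tuple N m)).ind (0 + i) = s.tuple N m i :=
      e.setBlock_ind 0 _
    have hval := fun i => hX.value_ofTerm (t := ts i) hD hs hv
      ((Set.subset_iUnion (fun i => (↑(ts i).varFinset : Set ℕ)) i).trans hfree)
    constructor
    · exact fun h => ⟨_, hval, h⟩
    · rintro ⟨a, ha, hR⟩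
      convert hR with i
      exact Option.some.inj ((hval i).symm.trans (ha i))
  | const t =>
    simp only [toSO, SOFormula.sat_allBlock, SOFormula.Sat, SOFormula.sat_memRl_setBlock, he,
      Set.forall_mem_image, Sat]
    refine forall₂_congr fun s hs => ?_
    have he' : (e.setBlock 0 (s.tuple N m)).rl N k = Assignment.tuple N m '' X := he
    simp only [he', Set.forall_mem_image]
    refine forall₂_congr fun s' hs' => ?_
    rw [hX.value_ofTerm (m := m) (b := 0)
        (e := (e.setBlock 0 (s.tuple N m)).setBlock N (s'.tuple N m)) hD hs ?_ hfree,
      hX.value_ofTerm (m := m) (b := N)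
        (e := (e.setBlock 0 (s.tuple N m)).setBlock N (s'.tuple N m)) hD hs' ?_ hfree,
      Option.some_inj]
    · exact SOVal.setBlock_ind _ _ _
    · intro i
      rw [SOVal.setBlock_ind_of_lt _ _ (by omega), SOVal.setBlock_ind]
  | bot =>
    simp only [toSO, SOFormula.sat_allBlock, SOFormula.Sat, SOFormula.sat_memRl_setBlock, he,
      Set.forall_mem_image, Sat]
    exact Set.eq_empty_iff_forall_notMem.symm
  | and φ ψ ih1 ih2 =>
    obtain ⟨h1, h2⟩ := Set.union_subset_iff.1 hfree
    obtain ⟨b1, b2⟩ := max_le_iff.1 hbound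
    rw [toSO, SOFormula.sat_and, ih1 hD h1 b1 hX he, ih2 hD h2 b2 hX he]
    rfl
  | or φ ψ ih1 ih2 =>
    obtain ⟨h1, h2⟩ := Set.union_subset_iff.1 hfree
    obtain ⟨b1, b2⟩ := max_le_iff.1 hbound
    rw [toSO, SOFormula.Sat, SOFormula.sat_neg, ih1 hD h1 b1 hX he, ih2 hD h2 b2 hX he]
    exact or_iff_not_imp_left.symm
  | imp φ ψ ih1 ih2 =>
    obtain ⟨h1, h2⟩ := Set.union_subset_iff.1 hfree
    obtain ⟨b1, b2⟩ := max_le_iff.1 hbound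
    have hsub : ∀ R : Set (Fin N → M),
        (SOFormula.allBlock 0 N (.imp (.memRl N (k + 1) 0) (.memRl N k 0)) : SOFormula L).Sat M
          (e.setRl N (k + 1) R) ↔ R ⊆ Assignment.tuple N m '' X := by
      intro R
      simp only [SOFormula.sat_allBlock, SOFormula.Sat, SOFormula.sat_memRl_setBlock,
        SOVal.setRl_rl, SOVal.setRl_rl_of_ne _ _ _ (Nat.succ_ne_self k).symm, he]
      rfl
    -- Subsets of the image are the images of subteams, so the relation quantifier becomes the
    -- quantifier over `Y`.
    simp only [toSO, SOFormula.Sat, hsub, Set.forall_subset_image_iff, Sat]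
    refine forall₂_congr fun Y hY => ?_
    have hYD : Team.HasDomain Y D := fun s hs => hX s (hY hs)
    rw [ih1 hD h1 b1 hYD (e.setRl_rl _ _ _), ih2 hD h2 b2 hYD (e.setRl_rl _ _ _)]
  | all x φ ih =>
    obtain ⟨b1, b2⟩ := max_le_iff.1 hbound
    have hx : x < N := b1
    rw [toSO, SOFormula.sat_letRl (S := Assignment.tuple N m '' X.duplicate x)]
    · refine ih ?_ (Set.sdiff_singleton_subset_iff.1 hfree) b2 (hX.duplicate x) (e.setRl_rl _ _ _)
      rintro y (rfl | hy)
      exacts [hx, hD y hy]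
    · intro R v
      rw [SOFormula.sat_ex, Team.image_tuple_duplicate hx]
      refine exists_congr fun a => ?_
      rw [SOFormula.Sat, value_replaceVar hx, ← he,
        ← SOVal.setRl_rl_of_ne e N R (Nat.succ_ne_self k).symm]
      rfl
  | ex x φ ih =>
    obtain ⟨b1, b2⟩ := max_le_iff.1 hbound
    have hx : x < N := b1
    have key : ∀ (F : X → M) (f : (Fin N → M) → M), (∀ s : X, f (s.1.tuple N m) = F s) →
        ((SOFormula.letRl N (k + 1)
          (.ex N (.and (.rvar N k (replaceVar N x))
            (.equal (.var x) (.fvar N 0 (replaceVar N x)))))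
          (φ.toSO N (k + 1))).Sat M (e.setFn N 0 f) ↔ φ.Sat M (X.supplement x F)) := by
      intro F f hf
      rw [SOFormula.sat_letRl (S := Assignment.tuple N m '' X.supplement x F)]
      · refine ih ?_ (Set.sdiff_singleton_subset_iff.1 hfree) b2 (hX.supplement x F)
          (SOVal.setRl_rl _ _ _ _)
        rintro y (rfl | hy)
        exacts [hx, hD y hy]
      · intro R v
        rw [SOFormula.sat_ex, Team.image_tuple_supplement hx m X F hf]
        refine exists_congr fun a => ?_
        have hvx : ((((e.setFn N 0 f).setRl N (k + 1) R).setBlock 0 v).setInd N a).ind x =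
            v ⟨x, hx⟩ := by
          have := ((e.setFn N 0 f).setRl N (k + 1) R).setBlock_ind 0 v ⟨x, hx⟩
          simpa [SOVal.setInd, hx.ne] using this
        rw [SOFormula.sat_and, SOFormula.Sat, SOFormula.Sat, SOTerm.value, SOTerm.value,
          value_replaceVar hx, hvx, ← he]
        refine and_congr ?_ ?_
        · rw [← SOVal.setRl_rl_of_ne e N R (Nat.succ_ne_self k).symm]
          rfl
        · have : ((((e.setFn N 0 f).setRl N (k + 1) R).setBlock 0 v).setInd N a).fn N 0 = f :=
            e.setFn_fn N 0 f
          rw [this]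
    rw [toSO, SOFormula.sat_exFn]
    constructor
    · rintro ⟨f, hf⟩
      exact ⟨fun s => f (s.1.tuple N m), (key _ f fun _ => rfl).1 hf⟩
    · rintro ⟨F, hF⟩
      have hinj : Function.Injective fun s : X => s.1.tuple N m :=
        fun s s' h => Subtype.ext (hX.injOn_tuple hD m s.2 s'.2 h)
      -- Injectivity of the coding lets `F` be read on tuples; the value `m` off the team is never
      -- used.
      exact ⟨Function.extend (fun s : X => s.1.tuple N m) F fun _ => m,
        (key F _ fun s => hinj.extend_apply F _ s).2 hF⟩

end IDFormula

/-! ### Sentences: describing the team of the empty assignment -/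

namespace SOFormula

/-- Every sentence of intuitionistic dependence logic is expressible in second-order logic. -/
theorem exists_sentence_of_ID (φ : IDFormula L) (hφ : φ.IsSentence) :
    ∃ ψ : SOFormula L, ψ.IsSentence ∧
      ∀ (M : Type w) [L.Structure M] [Nonempty M], ψ.IsTrue M ↔ φ.IsTrue M := by
  let N := φ.boundSup
  -- The empty assignment is coded by a constant tuple, here with the value of the variable `N` as
  -- default. The inner formula is Leibniz equality with that tuple. The default is irrelevant to
  -- truth, so the universal closure is harmless.
  obtain ⟨ψ, hψ, h⟩ := exists_closure.{u, v, w} (letRl N 0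
    (allRl N 1 (imp (rvar N 1 fun _ => .var N) (memRl N 1 0))) (φ.toSO N 0))
  refine ⟨ψ, hψ, fun M _ _ => (h M).trans ?_⟩
  have key : ∀ e : SOVal M, (letRl N 0
      (allRl N 1 (imp (rvar N 1 fun _ => .var N) (memRl N 1 0))) (φ.toSO N 0)).Sat M e ↔
        φ.IsTrue M := by
    intro e
    rw [sat_letRl (S := {fun _ => e.ind N})]
    · refine IDFormula.sat_toSO (m := e.ind N) φ (D := ∅) (by simp)
        (le_of_eq hφ) le_rfl ?_ ?_
      · rintro _ rfl x
        simp [Assignment.empty]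
      · rw [SOVal.setRl_rl, Set.image_singleton]
        rfl
    · intro R v
      have hN : ((e.setRl N 0 R).setBlock 0 v).ind N = e.ind N :=
        SOVal.setBlock_ind_of_ge _ v (Nat.zero_add N).le
      have hmem : ∀ S : Set (Fin N → M),
          (memRl N 1 0 : SOFormula L).Sat M (((e.setRl N 0 R).setBlock 0 v).setRl N 1 S) ↔
            v ∈ S := fun S => by
        have := sat_memRl_setBlock (L := L) N 1 0 v ((e.setRl N 0 R).setRl N 1 S)
        rwa [SOVal.setRl_rl] at this
      have hconst : ∀ S : Set (Fin N → M), (rvar N 1 fun _ => .var N : SOFormula L).Sat M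
          (((e.setRl N 0 R).setBlock 0 v).setRl N 1 S) ↔ (fun _ => e.ind N) ∈ S := fun S => by
        rw [Sat, SOVal.setRl_rl, ← hN]
        rfl
      simp only [Sat] at hconst ⊢
      simp only [hmem, hconst]
      constructor
      -- Leibniz equality is instantiated at the singleton of the constant tuple.
      · exact fun h => h _ rfl
      · rintro rfl S hS
        exact hS
  constructor
  · intro h
    obtain ⟨a⟩ := ‹Nonempty M›
    exact (key ⟨fun _ => a, fun _ _ _ => a, fun _ _ => ∅⟩).1 (h _)
  · exact fun h e => (key e).2 h

end SOFormula

end TeamLogic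

/-- Second-order sentences are expressible in intuitionistic dependence logic, and vice versa. -/
theorem theorem5 (L : FirstOrder.Language.{u, v}) :
    (∀ ψ : TeamLogic.SOFormula L, ψ.IsSentence →
      ∃ φ : TeamLogic.IDFormula L, φ.IsSentence ∧
        ∀ (M : Type w) [L.Structure M] [Nonempty M], ψ.IsTrue M ↔ φ.IsTrue M) ∧
    (∀ φ : TeamLogic.IDFormula L, φ.IsSentence →
      ∃ ψ : TeamLogic.SOFormula L, ψ.IsSentence ∧
        ∀ (M : Type w) [L.Structure M] [Nonempty M], ψ.IsTrue M ↔ φ.IsTrue M) :=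
  ⟨TeamLogic.IDFormula.exists_sentence_of_SO, TeamLogic.SOFormula.exists_sentence_of_ID⟩
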